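/- Let $\Gamma=(V,E)$ be a finite simple graph and let $(G_v)_{v\in V}$ be a family of nontrivial finite groups. Let $G$ be the graph product of $(\Gamma, G_v)$, that is, the quotient of the free product of the groups $G_v$, $v \in V$, by the normal closure of $\{g^{-1}h^{-1}gh : g\in G_u,\ h\in G_v,\ \{u,v\}\in E\}$. For $A\subseteq V$ let $G(A)$ denote the subgroup of $G$ generated by the images of the groups $G_a$ with $a\in A$. A clique is a set of pairwise adjacent vertices that is maximal (with respect to inclusion) among such sets. Then a subgroup $F$ of $G$ is a maximal finite subgroup of $G$ (a maximal element, with respect to inclusion, of the set of finite subgroups of $G$) if and only if there exists a clique $C$ of $\Gamma$ such that $F$ is conjugate in $G$ to $G(C)$. -/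

import Mathlib

universe u w

/-- The commutators `g⁻¹h⁻¹gh` in the free product of the groups `G v`, where `g` and `h` are
taken from vertex groups of adjacent vertices. -/
def graphProductRelators {V : Type u} (Γ : SimpleGraph V) (G : V → Type w) [∀ v, Group (G v)] :
    Set (Monoid.CoprodI G) :=
  {x | ∃ (a b : V) (g : G a) (h : G b), Γ.Adj a b ∧
    x = (Monoid.CoprodI.of g)⁻¹ * (Monoid.CoprodI.of h)⁻¹ *
      Monoid.CoprodI.of g * Monoid.CoprodI.of h}

/-- The graph product: the quotient of the free product of the vertex groups by the normal closure
of the commutators of elements of adjacent vertex groups. -/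
abbrev GraphProduct {V : Type u} (Γ : SimpleGraph V) (G : V → Type w) [∀ v, Group (G v)] :
    Type (max u w) :=
  Monoid.CoprodI G ⧸ Subgroup.normalClosure (graphProductRelators Γ G)

namespace GraphProduct

/-- The canonical homomorphism from a vertex group to the graph product. -/
def of {V : Type u} (Γ : SimpleGraph V) (G : V → Type w) [∀ v, Group (G v)] (v : V) :
    G v →* GraphProduct Γ G :=
  (QuotientGroup.mk' (Subgroup.normalClosure (graphProductRelators Γ G))).comp
    Monoid.CoprodI.of

/-- The subgroup `G(A)` of the graph product generated by the vertex groups `G a` with `a ∈ A`. -/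
def sub {V : Type u} (Γ : SimpleGraph V) (G : V → Type w) [∀ v, Group (G v)] (A : Set V) :
    Subgroup (GraphProduct Γ G) :=
  Subgroup.closure (⋃ a ∈ A, Set.range (of Γ G a))

end GraphProduct

/-! Splitting off a vertex `v` presents the graph product as `N ⋊ G(V ∖ {v})`, where `N` is a free
product of copies of `G v` indexed by the cosets of `G(lk v)`, permuted by `G(V ∖ {v})`. This group
acts on `N` by isometries for the syllable distance. Centres of minimal radius of a finite orbit are
pairwise at distance at most one, so they form a single point or lie in one coset of a free factor
(a panel). A finite subgroup therefore fixes a point or a panel (`exists_fixed_of_finite`), which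
makes it conjugate into `G(V ∖ {v})` or into `G(star v)` (`exists_conj_mem_compl_or_star`).
Induction on the vertex set, with retractions keeping conjugators under control, conjugates every
finite subgroup into some `G(C)` with `C` complete (`exists_conj_mem_clique`). Such `G(C)` are
finite, and the projection to `∏ G v` shows that an inclusion between conjugates of `G(C)` and
`G(D)` forces `C ⊆ D`. -/

namespace Monoid.CoprodI

/-! ### Syllable length and circumcentres in free products. -/

section Length

variable {ι : Type*} {M : ι → Type*} [∀ i, Group (M i)]

open Classical in
/-- The number of syllables in the reduced word representing an element of a free product. -/
noncomputable def syllableLength (x : CoprodI M) : ℕ :=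
  (Word.equiv x).toList.length

theorem syllableLength_one : syllableLength (1 : CoprodI M) = 0 := by
  classical
  have h : Word.equiv (1 : CoprodI M) = Word.empty := by
    rw [← Equiv.eq_symm_apply]
    exact Word.prod_empty.symm
  unfold syllableLength
  convert congrArg (fun w : Word M => w.toList.length) h
  rfl

theorem syllableLength_prod {i j : ι} (w : NeWord M i j) :
    syllableLength w.prod = w.toList.length := by
  classical
  have h : Word.equiv w.prod = w.toWord := by
    rw [← Equiv.eq_symm_apply]
    rfl
  unfold syllableLength
  convert congrArg (fun w : Word M => w.toList.length) h
  rfl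

theorem exists_neWord_of_ne_one {x : CoprodI M} (hx : x ≠ 1) :
    ∃ (i j : ι) (w : NeWord M i j), w.prod = x := by
  classical
  have h : Word.equiv x ≠ Word.empty := by
    intro h
    rw [← Equiv.eq_symm_apply] at h
    exact hx (h.trans Word.prod_empty)
  obtain ⟨i, j, w, hw⟩ := NeWord.of_word _ h
  refine ⟨i, j, w, ?_⟩
  rw [NeWord.prod, hw]
  exact Word.equiv.symm_apply_apply x

theorem NeWord.length_toList_inv {i j : ι} (w : NeWord M i j) :
    w.inv.toList.length = w.toList.length := by
  induction w with
  | singleton => rfl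
  | append _ _ _ h₁ h₂ => simp [NeWord.inv, h₁, h₂, add_comm]

theorem NeWord.length_toList_pos {i j : ι} (w : NeWord M i j) : 0 < w.toList.length :=
  List.length_pos_iff.mpr w.toList_ne_nil

theorem syllableLength_inv_mul {i j k l : ι} (hik : i ≠ k) (w : NeWord M i j) (w' : NeWord M k l) :
    syllableLength (w.prod⁻¹ * w'.prod) = w.toList.length + w'.toList.length := by
  rw [← NeWord.inv_prod, ← NeWord.append_prod (hne := hik), syllableLength_prod]
  simp [NeWord.length_toList_inv]

theorem eq_of_of_syllableLength_le_one {x : CoprodI M} (hx : x ≠ 1) (h : syllableLength x ≤ 1) :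
    ∃ (i : ι) (m : M i), x = of m := by
  obtain ⟨i, j, w, rfl⟩ := exists_neWord_of_ne_one hx
  rw [syllableLength_prod] at h
  cases w with
  | singleton m hm => exact ⟨_, m, NeWord.prod_singleton m hm⟩
  | append w₁ _ w₂ =>
    have h₁ := w₁.length_toList_pos
    have h₂ := w₂.length_toList_pos
    simp only [NeWord.toList, List.length_append] at h
    omega

theorem NeWord.exists_of_mul_prod {i j : ι} (w : NeWord M i j) (h : 2 ≤ w.toList.length) :
    ∃ m : M i, m ≠ 1 ∧ ∃ k, k ≠ i ∧ ∃ w' : NeWord M k j, w.prod = of m * w'.prod := by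
  induction w with
  | singleton => simp at h
  | @append i j k l w₁ hne w₂ ih₁ _ =>
    rcases lt_or_ge w₁.toList.length 2 with h₁ | h₁
    · cases w₁ with
      | singleton m hm => exact ⟨m, hm, k, hne.symm, w₂, by simp⟩
      | append u₁ _ u₂ =>
        have h₃ := u₁.length_toList_pos
        have h₄ := u₂.length_toList_pos
        simp only [NeWord.toList, List.length_append] at h₁
        omega
    · obtain ⟨m, hm, p, hp, w', hw'⟩ := ih₁ h₁
      exact ⟨m, hm, p, hp, w'.append hne w₂, by simp [hw', mul_assoc]⟩

/-- Strict convexity: moving from `x` one syllable towards `y` brings every point strictly closer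
than it was to `x` or to `y`. -/
theorem exists_syllableLength_lt_max {x y : CoprodI M} (h : 2 ≤ syllableLength (x⁻¹ * y)) :
    ∃ z : CoprodI M, ∀ s : CoprodI M, syllableLength (z⁻¹ * s) <
      max (syllableLength (x⁻¹ * s)) (syllableLength (y⁻¹ * s)) := by
  have hne : x⁻¹ * y ≠ 1 := by
    intro h1
    rw [h1, syllableLength_one] at h
    omega
  obtain ⟨i, j, w, hw⟩ := exists_neWord_of_ne_one hne
  rw [← hw, syllableLength_prod] at h
  obtain ⟨m, hm, k, hk, w', hw'⟩ := w.exists_of_mul_prod h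
  refine ⟨x * of m, fun s => ?_⟩
  set u : NeWord M i i := NeWord.singleton m⁻¹ (inv_ne_one.mpr hm) with hu
  have hup : u.prod = (of m)⁻¹ := by rw [hu, NeWord.prod_singleton, map_inv]
  obtain ⟨t, rfl⟩ : ∃ t, s = x * of m * t := ⟨(x * of m)⁻¹ * s, by group⟩
  have hx : x⁻¹ * (x * of m * t) = u.prod⁻¹ * t := by rw [hup]; group
  have hy : y⁻¹ * (x * of m * t) = w'.prod⁻¹ * t := by
    have : w'.prod = (of m)⁻¹ * x⁻¹ * y := by rw [mul_assoc, ← hw, hw']; group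
    rw [this]; group
  rw [hx, hy, inv_mul_cancel_left]
  by_cases ht : t = 1
  · subst ht
    refine lt_max_of_lt_left ?_
    rw [mul_one, ← NeWord.inv_prod, syllableLength_prod, syllableLength_one]
    exact NeWord.length_toList_pos _
  · obtain ⟨p, q, v, rfl⟩ := exists_neWord_of_ne_one ht
    -- Seen from `z`, the points `x` and `y` lie in the directions of the distinct factors `i` and
    -- `k`. The word to `s` starts in at most one of them, so nothing cancels on the path from the
    -- other.
    by_cases hp : i = p
    · refine lt_max_of_lt_right ?_
      rw [syllableLength_inv_mul (hp ▸ hk), syllableLength_prod]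
      have := w'.length_toList_pos
      omega
    · refine lt_max_of_lt_left ?_
      rw [syllableLength_inv_mul hp, syllableLength_prod]
      have := u.length_toList_pos
      omega

/-- A finite subset of a free product has a circumcentre: the centres of minimal radius are at
distance at most one from each other. -/
theorem syllableLength_le_one_of_minimal_radius (S : Finset (CoprodI M)) (hS : S.Nonempty)
    {x y : CoprodI M}
    (hx : ∀ z, S.sup (fun s => syllableLength (x⁻¹ * s)) ≤ S.sup fun s => syllableLength (z⁻¹ * s))
    (hy : ∀ z, S.sup (fun s => syllableLength (y⁻¹ * s)) ≤ S.sup fun s => syllableLength (z⁻¹ * s)) :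
    syllableLength (x⁻¹ * y) ≤ 1 := by
  by_contra! h
  obtain ⟨z, hz⟩ := exists_syllableLength_lt_max h
  obtain ⟨s, hs, hs'⟩ := Finset.exists_mem_eq_sup S hS fun s => syllableLength (z⁻¹ * s)
  have h₁ := hx z
  have h₂ := hy z
  have h₃ := Finset.le_sup (f := fun s => syllableLength (x⁻¹ * s)) hs
  have h₄ := Finset.le_sup (f := fun s => syllableLength (y⁻¹ * s)) hs
  have h₅ := hz s
  rcases lt_max_iff.mp h₅ with h₆ | h₆ <;> omega

end Length

/-! ### Fixed points of finite groups acting on a free power. -/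

section Permuting

variable {ι L H : Type*} [Group L] [Group H] [MulAction H ι]

theorem of_left_cancel_index {i j : ι} {l l' : L} (hl : l ≠ 1)
    (h : of (M := fun _ : ι => L) (i := i) l = of (M := fun _ : ι => L) (i := j) l') : i = j := by
  classical
  by_contra hij
  have h' := congrArg (lift (M := fun _ : ι => L)
    (Pi.mulSingle i (MonoidHom.id L) : ι → L →* L)) h
  rw [lift_of, lift_of, Pi.mulSingle_eq_same, Pi.mulSingle_eq_of_ne (Ne.symm hij)] at h'
  exact hl h'

variable (φ : H →* MulAut (CoprodI fun _ : ι => L))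
  (hφ : ∀ (h : H) (i : ι) (l : L), φ h (of (M := fun _ : ι => L) (i := i) l) =
    of (M := fun _ : ι => L) (i := h • i) l)

include hφ

theorem exists_neWord_map (h : H) {i j : ι} (w : NeWord (fun _ : ι => L) i j) :
    ∃ w' : NeWord (fun _ : ι => L) (h • i) (h • j),
      w'.prod = φ h w.prod ∧ w'.toList.length = w.toList.length := by
  induction w with
  | singleton m hm => exact ⟨NeWord.singleton m hm, by simp [hφ], rfl⟩
  | append w₁ hne w₂ ih₁ ih₂ =>
    obtain ⟨v₁, h₁, h₁'⟩ := ih₁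
    obtain ⟨v₂, h₂, h₂'⟩ := ih₂
    exact ⟨v₁.append (fun e => hne (MulAction.injective h e)) v₂, by simp [h₁, h₂],
      by simp [h₁', h₂']⟩

theorem syllableLength_map (h : H) (x : CoprodI fun _ : ι => L) :
    syllableLength (φ h x) = syllableLength x := by
  by_cases hx : x = 1
  · simp [hx]
  · obtain ⟨i, j, w, rfl⟩ := exists_neWord_of_ne_one hx
    obtain ⟨w', h₁, h₂⟩ := exists_neWord_map φ hφ h w
    rw [← h₁, syllableLength_prod, syllableLength_prod, h₂]

/-- A finite subgroup of `(∗_ι L) ⋊ H`, where `H` permutes the free factors, fixes a vertex or a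
panel of the free product. -/
theorem exists_fixed_of_finite (F : Subgroup ((CoprodI fun _ : ι => L) ⋊[φ] H)) [Finite F] :
    ∃ x : CoprodI fun _ : ι => L,
      (∀ f ∈ F, x⁻¹ * f.left * φ f.right x = 1) ∨
      ∃ i : ι, ∀ f ∈ F, f.right • i = i ∧
        ∃ l : L, x⁻¹ * f.left * φ f.right x = of (M := fun _ : ι => L) (i := i) l := by
  classical
  have := Fintype.ofFinite F
  -- `S` is the orbit of `1` under the action `f • x = f.left * φ f.right x`.
  set S : Finset (CoprodI fun _ : ι => L) := Finset.univ.image fun f : F => f.1.left with hSdef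
  have hS : S.Nonempty := ⟨_, Finset.mem_image_of_mem _ (Finset.mem_univ 1)⟩
  set r : (CoprodI fun _ : ι => L) → ℕ := fun x => S.sup fun s => syllableLength (x⁻¹ * s)
  have hmove : ∀ f ∈ F, ∀ x, r (f.left * φ f.right x) ≤ r x := by
    intro f hf x
    refine Finset.sup_le fun s hs => ?_
    obtain ⟨f', -, rfl⟩ := Finset.mem_image.mp hs
    have h₁ : (f⁻¹ * f'.1).left ∈ S :=
      Finset.mem_image.mpr ⟨⟨f⁻¹ * f'.1, F.mul_mem (F.inv_mem hf) f'.2⟩, Finset.mem_univ _, rfl⟩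
    have h₂ : f'.1.left = f.left * φ f.right (f⁻¹ * f'.1).left := by
      conv_lhs => rw [← mul_inv_cancel_left f f'.1]
      rfl
    have h₃ := Finset.le_sup (f := fun s => syllableLength (x⁻¹ * s)) h₁
    have h₄ : (f.left * φ f.right x)⁻¹ * f'.1.left = φ f.right (x⁻¹ * (f⁻¹ * f'.1).left) := by
      rw [h₂, map_mul, map_inv]; group
    rw [h₄, syllableLength_map φ hφ]
    exact h₃
  obtain ⟨x, hx⟩ : ∃ x, ∀ z, r x ≤ r z :=
    ⟨Function.argmin r, fun z => Function.argmin_le r z⟩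
  have hfx : ∀ f ∈ F, ∀ x, (∀ z, r x ≤ r z) → ∀ z, r (f.left * φ f.right x) ≤ r z :=
    fun f hf x hx z => (hmove f hf x).trans (hx z)
  have hdist : ∀ {x y}, (∀ z, r x ≤ r z) → (∀ z, r y ≤ r z) → syllableLength (x⁻¹ * y) ≤ 1 :=
    fun hx hy => syllableLength_le_one_of_minimal_radius S hS hx hy
  refine ⟨x, ?_⟩
  by_cases hM : ∀ y, (∀ z, r y ≤ r z) → y = x
  · left
    intro f hf
    rw [mul_assoc, hM _ (hfx f hf x hx), inv_mul_cancel]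
  right
  push Not at hM
  obtain ⟨y, hy, hyx⟩ := hM
  obtain ⟨i, l, hl⟩ := eq_of_of_syllableLength_le_one
    (fun e => hyx (inv_mul_eq_one.mp e).symm) (hdist hx hy)
  have hl1 : l ≠ 1 := by
    rintro rfl
    rw [map_one] at hl
    exact hyx (inv_mul_eq_one.mp hl).symm
  -- A second centre `y` determines the panel: a centre leaving `x` through another factor would be
  -- at distance two from `y`.
  have hpanel : ∀ z, (∀ z', r z ≤ r z') →
      ∃ m : L, x⁻¹ * z = of (M := fun _ : ι => L) (i := i) m := by
    intro z hz
    by_cases hzx : x⁻¹ * z = 1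
    · exact ⟨1, by rw [hzx, map_one]⟩
    obtain ⟨j, m, hm⟩ := eq_of_of_syllableLength_le_one hzx (hdist hx hz)
    by_cases hij : i = j
    · subst hij
      exact ⟨m, hm⟩
    exfalso
    have hm1 : m ≠ 1 := by
      rintro rfl
      exact hzx (by rw [hm, map_one])
    have h₁ := hdist hy hz
    have h₂ : y⁻¹ * z = (NeWord.singleton (M := fun _ : ι => L) (i := i) l hl1).prod⁻¹ *
        (NeWord.singleton (M := fun _ : ι => L) (i := j) m hm1).prod := by
      rw [NeWord.prod_singleton, NeWord.prod_singleton, ← hl, ← hm]; group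
    rw [h₂, syllableLength_inv_mul hij] at h₁
    simp at h₁
  refine ⟨i, fun f hf => ?_⟩
  obtain ⟨m, hm⟩ := hpanel _ (hfx f hf x hx)
  obtain ⟨m', hm'⟩ := hpanel _ (hfx f hf y hy)
  refine ⟨?_, m, by rw [mul_assoc, hm]⟩
  have h₁ : φ f.right (x⁻¹ * y) = of (M := fun _ : ι => L) (i := i) (m⁻¹ * m') := by
    rw [map_mul (of (M := fun _ : ι => L) (i := i)), map_inv (of (M := fun _ : ι => L) (i := i)),
      ← hm, ← hm', map_mul, map_inv]
    group
  rw [hl, hφ] at h₁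
  exact of_left_cancel_index hl1 h₁

end Permuting

end Monoid.CoprodI

/-! ### The permutation action on a free power. -/

namespace Monoid.CoprodI

variable (ι L H : Type*) [Group L] [Group H] [MulAction H ι]

/-- The action of `H` on a free power of `L` by permutation of the free factors. -/
def permuteFactors : H →* MulAut (CoprodI fun _ : ι => L) :=
  have hmul : ∀ h h' : H,
      (lift (M := fun _ : ι => L) fun i => of (M := fun _ : ι => L) (i := h • i)).comp
        (lift (M := fun _ : ι => L) fun i => of (M := fun _ : ι => L) (i := h' • i)) =
      lift (M := fun _ : ι => L) fun i => of (M := fun _ : ι => L) (i := (h * h') • i) := by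
    intro h h'
    refine ext_hom _ _ fun i => MonoidHom.ext fun l => ?_
    simp only [MonoidHom.comp_apply, lift_of, mul_smul]
  have hone : (lift (M := fun _ : ι => L) fun i => of (M := fun _ : ι => L) (i := (1 : H) • i)) =
      MonoidHom.id _ := by
    refine ext_hom _ _ fun i => MonoidHom.ext fun l => ?_
    simp only [MonoidHom.comp_apply, lift_of, one_smul, MonoidHom.id_apply]
  { toFun := fun h => MonoidHom.toMulEquiv
      (lift (M := fun _ : ι => L) fun i => of (M := fun _ : ι => L) (i := h • i))
      (lift (M := fun _ : ι => L) fun i => of (M := fun _ : ι => L) (i := h⁻¹ • i))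
      (by rw [hmul, inv_mul_cancel, hone]) (by rw [hmul, mul_inv_cancel, hone])
    map_one' := MulEquiv.ext fun x => DFunLike.congr_fun hone x
    map_mul' := fun h h' => MulEquiv.ext fun x => (DFunLike.congr_fun (hmul h h') x).symm }

variable {ι L H}

theorem permuteFactors_of (h : H) (i : ι) (l : L) :
    permuteFactors ι L H h (of (M := fun _ : ι => L) (i := i) l) =
      of (M := fun _ : ι => L) (i := h • i) l :=
  lift_of _ _

end Monoid.CoprodI

theorem Subgroup.finite_map {X Y : Type*} [Group X] [Group Y] (K : Subgroup X) [Finite K]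
    (φ : X →* Y) : Finite (K.map φ) :=
  Set.Finite.to_subtype ((Set.toFinite (K : Set X)).image φ)

namespace GraphProduct

open Monoid

/-! ### Universal property, the subgroups `G(A)` and their retractions. -/

section Basic

variable {V : Type u} {Γ : SimpleGraph V} {G : V → Type w} [∀ v, Group (G v)]

theorem commute_of_adj {a b : V} (hab : Γ.Adj a b) (g : G a) (h : G b) :
    Commute (of Γ G a g) (of Γ G b h) := by
  have hrel : (QuotientGroup.mk' (Subgroup.normalClosure (graphProductRelators Γ G)))
      ((CoprodI.of g)⁻¹ * (CoprodI.of h)⁻¹ * CoprodI.of g * CoprodI.of h) = 1 :=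
    (QuotientGroup.eq_one_iff _).mpr (Subgroup.subset_normalClosure ⟨a, b, g, h, hab, rfl⟩)
  change (of Γ G a g)⁻¹ * (of Γ G b h)⁻¹ * of Γ G a g * of Γ G b h = 1 at hrel
  rw [mul_assoc, ← mul_inv_rev] at hrel
  exact inv_mul_eq_one.mp hrel |>.symm

/-- The universal property of the graph product. -/
def lift {X : Type*} [Group X] (f : ∀ v, G v →* X)
    (hf : ∀ a b, Γ.Adj a b → ∀ g h, Commute (f a g) (f b h)) : GraphProduct Γ G →* X :=
  QuotientGroup.lift _ (CoprodI.lift f) <| by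
    refine Subgroup.normalClosure_le_normal ?_
    rintro _ ⟨a, b, g, h, hab, rfl⟩
    have := hf a b hab g h
    simp only [SetLike.mem_coe, MonoidHom.mem_ker, map_mul, map_inv, CoprodI.lift_of]
    rw [mul_assoc, ← mul_inv_rev, inv_mul_eq_one]
    exact this.symm

theorem lift_of {X : Type*} [Group X] (f : ∀ v, G v →* X)
    (hf : ∀ a b, Γ.Adj a b → ∀ g h, Commute (f a g) (f b h)) (v : V) (g : G v) :
    lift f hf (of Γ G v g) = f v g :=
  CoprodI.lift_of f g

theorem hom_ext {X : Type*} [Group X] {f f' : GraphProduct Γ G →* X}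
    (h : ∀ v g, f (of Γ G v g) = f' (of Γ G v g)) : f = f' :=
  QuotientGroup.monoidHom_ext _ (CoprodI.ext_hom _ _ fun v => MonoidHom.ext fun g => h v g)

theorem of_mem_sub {A : Set V} {a : V} (ha : a ∈ A) (g : G a) : of Γ G a g ∈ sub Γ G A :=
  Subgroup.subset_closure (Set.mem_biUnion ha ⟨g, rfl⟩)

theorem sub_le_iff {A : Set V} {K : Subgroup (GraphProduct Γ G)} :
    sub Γ G A ≤ K ↔ ∀ a ∈ A, ∀ g, of Γ G a g ∈ K := by
  refine ⟨fun h a ha g => h (of_mem_sub ha g), fun h => ?_⟩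
  refine (Subgroup.closure_le _).mpr (Set.iUnion₂_subset fun a ha => ?_)
  rintro _ ⟨g, rfl⟩
  exact h a ha g

theorem sub_mono {A B : Set V} (h : A ⊆ B) : sub Γ G A ≤ sub Γ G B :=
  sub_le_iff.mpr fun _ ha g => of_mem_sub (h ha) g

theorem sub_univ : sub Γ G Set.univ = ⊤ := by
  rw [eq_top_iff]
  have h : ((sub Γ G Set.univ).subtype.comp
      (lift (fun v => (of Γ G v).codRestrict (sub Γ G Set.univ)
        fun g => of_mem_sub (Set.mem_univ v) g)
      fun a b hab g h => Subtype.ext (commute_of_adj hab g h))) = MonoidHom.id _ :=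
    hom_ext fun v g => congrArg Subtype.val (lift_of _ _ v g)
  intro x _
  have hx := DFunLike.congr_fun h x
  rw [MonoidHom.id_apply] at hx
  rw [← hx]
  exact SetLike.coe_mem _

theorem commute_of_mem_sub {v : V} {B : Set V} (hB : B ⊆ Γ.neighborSet v) (g : G v)
    {x : GraphProduct Γ G} (hx : x ∈ sub Γ G B) : Commute (of Γ G v g) x := by
  have h : sub Γ G B ≤ Subgroup.centralizer {of Γ G v g} :=
    sub_le_iff.mpr fun b hb h => Subgroup.mem_centralizer_singleton_iff.mpr
      (commute_of_adj (hB hb) g h).symm.eq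
  exact (Subgroup.mem_centralizer_singleton_iff.mp (h hx)).symm

theorem exists_of_mul_of_mem_sub_insert {v : V} {B : Set V} (hB : B ⊆ Γ.neighborSet v)
    {x : GraphProduct Γ G} (hx : x ∈ sub Γ G (insert v B)) :
    ∃ g : G v, ∃ b ∈ sub Γ G B, x = of Γ G v g * b := by
  induction hx using Subgroup.closure_induction with
  | mem x hx =>
    obtain ⟨a, ha, g, rfl⟩ := Set.mem_iUnion₂.mp hx
    rcases ha with rfl | ha
    · exact ⟨g, 1, one_mem _, (mul_one _).symm⟩
    · exact ⟨1, _, of_mem_sub ha g, by rw [map_one, one_mul]⟩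
  | one => exact ⟨1, 1, one_mem _, by rw [map_one, one_mul]⟩
  | mul x y _ _ hx hy =>
    obtain ⟨g, b, hb, rfl⟩ := hx
    obtain ⟨g', b', hb', rfl⟩ := hy
    refine ⟨g * g', b * b', mul_mem hb hb', ?_⟩
    rw [map_mul, mul_assoc, mul_assoc, ← mul_assoc b, ← (commute_of_mem_sub hB g' hb).eq,
      mul_assoc]
  | inv x _ hx =>
    obtain ⟨g, b, hb, rfl⟩ := hx
    refine ⟨g⁻¹, b⁻¹, inv_mem hb, ?_⟩
    rw [mul_inv_rev, map_inv, ((commute_of_mem_sub hB g hb).inv_inv).eq]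

variable (Γ G) in
open Classical in
/-- The retraction of a graph product onto `G(A)` which kills the vertex groups outside `A`. -/
noncomputable def retraction (A : Set V) : GraphProduct Γ G →* GraphProduct Γ G :=
  lift (fun v => if v ∈ A then of Γ G v else 1) fun a b hab g h => by
    by_cases ha : a ∈ A <;> by_cases hb : b ∈ A <;> simp [ha, hb, commute_of_adj hab]

theorem retraction_of_mem {A : Set V} {v : V} (hv : v ∈ A) (g : G v) :
    retraction Γ G A (of Γ G v g) = of Γ G v g := by
  simp [retraction, lift_of, hv]

theorem retraction_of_notMem {A : Set V} {v : V} (hv : v ∉ A) (g : G v) :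
    retraction Γ G A (of Γ G v g) = 1 := by
  simp [retraction, lift_of, hv]

theorem retraction_mem_sub_inter (A : Set V) {B : Set V} {x : GraphProduct Γ G}
    (hx : x ∈ sub Γ G B) : retraction Γ G A x ∈ sub Γ G (A ∩ B) := by
  have h : sub Γ G B ≤ (sub Γ G (A ∩ B)).comap (retraction Γ G A) := by
    refine sub_le_iff.mpr fun b hb g => ?_
    rw [Subgroup.mem_comap]
    by_cases hA : b ∈ A
    · rw [retraction_of_mem hA]
      exact of_mem_sub (A := A ∩ B) ⟨hA, hb⟩ g
    · rw [retraction_of_notMem hA]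
      exact one_mem _
  exact h hx

theorem retraction_mem_sub (A : Set V) (x : GraphProduct Γ G) :
    retraction Γ G A x ∈ sub Γ G A := by
  have h := retraction_mem_sub_inter A (B := Set.univ) (x := x) (by rw [sub_univ]; trivial)
  rwa [Set.inter_univ] at h

theorem retraction_eq_self {A : Set V} {x : GraphProduct Γ G} (hx : x ∈ sub Γ G A) :
    retraction Γ G A x = x := by
  have h : sub Γ G A ≤ (retraction Γ G A).eqLocus (MonoidHom.id _) :=
    sub_le_iff.mpr fun _ ha g => retraction_of_mem ha g
  exact h hx

end Basic

/-! ### Splitting off one vertex group. -/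

section Decomposition

variable {V : Type u} (Γ : SimpleGraph V) (G : V → Type w) [∀ v, Group (G v)] (v : V)

/-- The cosets of `G(lk v)` in the subgroup `G(V ∖ {v})`. -/
abbrev LinkCosets : Type (max u w) :=
  sub Γ G {v}ᶜ ⧸ (sub Γ G (Γ.neighborSet v)).subgroupOf (sub Γ G {v}ᶜ)

/-- The semidirect product of `G(V ∖ {v})` with the free product of the conjugates of `G v`. -/
abbrev SplitProduct : Type (max u w) :=
  (CoprodI fun _ : LinkCosets Γ G v => G v) ⋊[CoprodI.permuteFactors (LinkCosets Γ G v) (G v)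
    (sub Γ G {v}ᶜ)] (sub Γ G {v}ᶜ)

open Classical in
/-- The homomorphisms from the vertex groups defining `toSplit`. -/
noncomputable def toSplitVertex (u : V) : G u →* SplitProduct Γ G v :=
  if h : u = v then
    (SemidirectProduct.inl.comp (CoprodI.of (M := fun _ : LinkCosets Γ G v => G v)
      (i := ((1 : sub Γ G {v}ᶜ) : LinkCosets Γ G v)))).comp
        (h.rec (motive := fun x _ => G u →* G x) (MonoidHom.id (G u)))
  else SemidirectProduct.inr.comp
    ((of Γ G u).codRestrict (sub Γ G {v}ᶜ) fun g => of_mem_sub h g)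

theorem toSplitVertex_self (g : G v) : toSplitVertex Γ G v v g =
    SemidirectProduct.inl (CoprodI.of (M := fun _ : LinkCosets Γ G v => G v)
        (i := ((1 : sub Γ G {v}ᶜ) : LinkCosets Γ G v)) g) := by
  simp [toSplitVertex]

theorem toSplitVertex_of_ne {u : V} (h : u ≠ v) (g : G u) : toSplitVertex Γ G v u g =
    SemidirectProduct.inr ⟨of Γ G u g, of_mem_sub h g⟩ := by
  simp only [toSplitVertex, h, dite_false]
  rfl

/-- An element of `G u` with `u` in the link of `v` fixes the trivial coset, hence acts trivially on
the free factor with that index. -/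
theorem commute_toSplitVertex {u : V} (huv : Γ.Adj v u) (g : G v) (h : G u) :
    Commute (toSplitVertex Γ G v v g) (toSplitVertex Γ G v u h) := by
  rw [toSplitVertex_self, toSplitVertex_of_ne Γ G v huv.ne']
  set k : sub Γ G {v}ᶜ := ⟨of Γ G u h, of_mem_sub huv.ne' h⟩ with hk
  have h₁ := SemidirectProduct.inl_aut
    (φ := CoprodI.permuteFactors (LinkCosets Γ G v) (G v) (sub Γ G {v}ᶜ)) k
    (CoprodI.of (M := fun _ : LinkCosets Γ G v => G v)
        (i := ((1 : sub Γ G {v}ᶜ) : LinkCosets Γ G v)) g)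
  have h₂ : k • ((1 : sub Γ G {v}ᶜ) : LinkCosets Γ G v) = ((1 : sub Γ G {v}ᶜ) : LinkCosets Γ G v) := by
    rw [MulAction.Quotient.smul_coe, smul_eq_mul, mul_one, eq_comm, QuotientGroup.eq, inv_one,
      one_mul, Subgroup.mem_subgroupOf]
    exact of_mem_sub (A := Γ.neighborSet v) huv h
  rw [CoprodI.permuteFactors_of, h₂, map_inv] at h₁
  exact eq_mul_inv_iff_mul_eq.mp h₁

/-- The homomorphism from a graph product to the semidirect product splitting off `G v`. -/
noncomputable def toSplit : GraphProduct Γ G →* SplitProduct Γ G v :=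
  lift (toSplitVertex Γ G v) fun a b hab g h => by
    by_cases ha : a = v
    · subst ha
      exact commute_toSplitVertex Γ G _ hab g h
    by_cases hb : b = v
    · subst hb
      exact (commute_toSplitVertex Γ G _ hab.symm h g).symm
    rw [toSplitVertex_of_ne Γ G v ha, toSplitVertex_of_ne Γ G v hb]
    refine Commute.map ?_ SemidirectProduct.inr
    exact Subtype.ext (commute_of_adj hab g h)

/-- The homomorphism from the free product of the conjugates of `G v`. -/
noncomputable def ofConjugates :
    (CoprodI fun _ : LinkCosets Γ G v => G v) →* GraphProduct Γ G :=
  CoprodI.lift fun i => (MulAut.conj (i.out : GraphProduct Γ G)).toMonoidHom.comp (of Γ G v)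

/-- The chosen coset representative is immaterial, since `G(lk v)` commutes with `G v`. -/
theorem ofConjugates_of (h : sub Γ G {v}ᶜ) (l : G v) :
    ofConjugates Γ G v (CoprodI.of (M := fun _ : LinkCosets Γ G v => G v)
      (i := (h : LinkCosets Γ G v)) l) = h * of Γ G v l * (h : GraphProduct Γ G)⁻¹ := by
  rw [ofConjugates, CoprodI.lift_of]
  obtain ⟨n, hn⟩ := QuotientGroup.mk_out_eq_mul
    ((sub Γ G (Γ.neighborSet v)).subgroupOf (sub Γ G {v}ᶜ)) h
  have hc := commute_of_mem_sub subset_rfl l (Subgroup.mem_subgroupOf.mp n.2)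
  simp only [MonoidHom.comp_apply, MulEquiv.coe_toMonoidHom, MulAut.conj_apply]
  rw [hn]
  simp only [Subgroup.coe_mul, mul_inv_rev]
  rw [mul_assoc (h : GraphProduct Γ G), ← hc.eq]
  group

/-- The homomorphism from the semidirect product back to the graph product. -/
noncomputable def ofSplit : SplitProduct Γ G v →* GraphProduct Γ G :=
  SemidirectProduct.lift (ofConjugates Γ G v) (sub Γ G {v}ᶜ).subtype fun h => by
    refine CoprodI.ext_hom _ _ fun i => MonoidHom.ext fun l => ?_
    obtain ⟨k, rfl⟩ := QuotientGroup.mk_surjective i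
    simp only [MonoidHom.comp_apply, MulEquiv.coe_toMonoidHom]
    rw [CoprodI.permuteFactors_of, MulAction.Quotient.smul_coe, ofConjugates_of, ofConjugates_of]
    simp [mul_assoc]

theorem ofSplit_toSplit (x : GraphProduct Γ G) : ofSplit Γ G v (toSplit Γ G v x) = x := by
  have h : (ofSplit Γ G v).comp (toSplit Γ G v) = MonoidHom.id _ := by
    refine hom_ext fun u g => ?_
    rw [MonoidHom.comp_apply, toSplit, lift_of]
    by_cases hu : u = v
    · subst hu
      rw [toSplitVertex_self, ofSplit, SemidirectProduct.lift_inl, ofConjugates_of]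
      simp
    · rw [toSplitVertex_of_ne Γ G v hu, ofSplit, SemidirectProduct.lift_inr]
      rfl
  exact DFunLike.congr_fun h x

/-- The displacement of `x` by `f` appears as the free-product part of `f` conjugated by `x`, so
fixed points and panels translate into conjugacy. -/
theorem ofConjugates_conj (x : CoprodI fun _ : LinkCosets Γ G v => G v) (f : GraphProduct Γ G) :
    (ofConjugates Γ G v x)⁻¹ * f * ofConjugates Γ G v x =
      ofConjugates Γ G v (x⁻¹ * (toSplit Γ G v f).left *
        CoprodI.permuteFactors (LinkCosets Γ G v) (G v) (sub Γ G {v}ᶜ) (toSplit Γ G v f).right x) *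
      (toSplit Γ G v f).right := by
  have h₁ : ∀ y, ofSplit Γ G v (SemidirectProduct.inl y) = ofConjugates Γ G v y :=
    fun y => SemidirectProduct.lift_inl _ _ _ y
  have h₂ : ∀ y, ofSplit Γ G v (SemidirectProduct.inr y) = y :=
    fun y => SemidirectProduct.lift_inr _ _ _ y
  conv_lhs => rw [← ofSplit_toSplit Γ G v f]
  rw [← h₁, ← h₁, ← h₂, ← map_inv, ← map_mul, ← map_mul, ← map_mul]
  congr 1
  ext <;> simp

/-- A finite subgroup of a graph product is conjugate into the subgroup generated by the vertex
groups other than `G v`, or into the subgroup generated by the star of `v`. -/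
theorem exists_conj_mem_compl_or_star (F : Subgroup (GraphProduct Γ G)) [Finite F] :
    ∃ y : GraphProduct Γ G, (∀ f ∈ F, y⁻¹ * f * y ∈ sub Γ G {v}ᶜ) ∨
      ∀ f ∈ F, y⁻¹ * f * y ∈ sub Γ G (insert v (Γ.neighborSet v)) := by
  have := F.finite_map (toSplit Γ G v)
  obtain ⟨x, h | ⟨i, h⟩⟩ := CoprodI.exists_fixed_of_finite
    (CoprodI.permuteFactors (LinkCosets Γ G v) (G v) (sub Γ G {v}ᶜ)) CoprodI.permuteFactors_of
    (F.map (toSplit Γ G v))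
  · refine ⟨ofConjugates Γ G v x, Or.inl fun f hf => ?_⟩
    rw [ofConjugates_conj, h _ (Subgroup.mem_map_of_mem _ hf), map_one, one_mul]
    exact SetLike.coe_mem _
  · obtain ⟨k, rfl⟩ := QuotientGroup.mk_surjective i
    refine ⟨ofConjugates Γ G v x * k, Or.inr fun f hf => ?_⟩
    obtain ⟨h₁, l, hl⟩ := h _ (Subgroup.mem_map_of_mem _ hf)
    set r := (toSplit Γ G v f).right with hr
    have h₂ : (ofConjugates Γ G v x * k)⁻¹ * f * (ofConjugates Γ G v x * k) =
        (k : GraphProduct Γ G)⁻¹ * ((ofConjugates Γ G v x)⁻¹ * f * ofConjugates Γ G v x) * k := by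
      group
    rw [h₂, ofConjugates_conj, hl, ofConjugates_of]
    -- `r` fixes the coset of `k` that indexes the panel.
    have h₃ : ((k⁻¹ * (r * k) : sub Γ G {v}ᶜ) : GraphProduct Γ G) ∈
        sub Γ G (Γ.neighborSet v) := by
      rw [MulAction.Quotient.smul_coe, smul_eq_mul, eq_comm, QuotientGroup.eq,
        Subgroup.mem_subgroupOf] at h₁
      exact h₁
    have h₄ : (k : GraphProduct Γ G)⁻¹ * (k * of Γ G v l * (k : GraphProduct Γ G)⁻¹ * r) * k =
        of Γ G v l * ((k⁻¹ * (r * k) : sub Γ G {v}ᶜ) : GraphProduct Γ G) := by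
      simp only [Subgroup.coe_mul, Subgroup.coe_inv]
      group
    rw [h₄]
    exact mul_mem (of_mem_sub (Set.mem_insert _ _) l) (sub_mono (Set.subset_insert _ _) h₃)

end Decomposition

end GraphProduct

/-! ### Finite subgroups are conjugate into complete subgraphs. -/

namespace GraphProduct

variable {V : Type u} {Γ : SimpleGraph V} {G : V → Type w} [∀ v, Group (G v)]

/-- Apply the retraction onto `G(A)`: it fixes `x` and replaces the conjugator by one inside `G(A)`.
-/
theorem conj_retraction_mem {A B : Set V} {x y : GraphProduct Γ G} (hx : x ∈ sub Γ G A)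
    (h : y⁻¹ * x * y ∈ sub Γ G B) :
    (retraction Γ G A y)⁻¹ * x * retraction Γ G A y ∈ sub Γ G (A ∩ B) := by
  have h₁ := retraction_mem_sub_inter A h
  rwa [map_mul, map_mul, map_inv, retraction_eq_self hx] at h₁

/-- A finite subgroup of `G(A)`, where `A` is finite, is conjugate into `G(C)` for some set `C` of
pairwise adjacent vertices. -/
theorem exists_conj_mem_clique {A : Set V} (hA : A.Finite) (F : Subgroup (GraphProduct Γ G))
    [Finite F] (hF : F ≤ sub Γ G A) :
    ∃ y : GraphProduct Γ G, ∃ C : Set V, Γ.IsClique C ∧ ∀ f ∈ F, y⁻¹ * f * y ∈ sub Γ G C := by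
  induction A, hA using Set.Finite.induction_on generalizing F with
  | empty => exact ⟨1, ∅, SimpleGraph.isClique_empty, fun f hf => by simpa using hF hf⟩
  | @insert v A _ _ ih =>
    obtain ⟨y₀, hy₀⟩ := exists_conj_mem_compl_or_star Γ G v F
    set y := retraction Γ G (insert v A) y₀
    have hconj : ∀ f, (MulAut.conj y⁻¹).toMonoidHom f = y⁻¹ * f * y := fun f => by simp
    set F₁ := F.map (MulAut.conj y⁻¹).toMonoidHom
    have : Finite F₁ := Subgroup.finite_map _ _
    suffices h : ∃ z : GraphProduct Γ G, ∃ C : Set V, Γ.IsClique C ∧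
        ∀ f ∈ F₁, z⁻¹ * f * z ∈ sub Γ G C by
      obtain ⟨z, C, hC, hz⟩ := h
      refine ⟨y * z, C, hC, fun f hf => ?_⟩
      have h₁ := hz _ (Subgroup.mem_map_of_mem _ hf)
      rw [hconj] at h₁
      convert h₁ using 1
      group
    rcases hy₀ with hy₀ | hy₀
    · refine ih F₁ ?_
      rintro _ ⟨f, hf, rfl⟩
      rw [hconj]
      refine sub_mono ?_ (conj_retraction_mem (hF hf) (hy₀ f hf))
      rintro a ⟨rfl | ha, ha'⟩
      · exact absurd rfl ha'
      · exact ha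
    -- Star case: `G v` commutes with `G(B)`, so the induction hypothesis is applied to the image in
    -- `G(B)`. The conjugator is then retracted into `G(B)`, where it commutes with `G v`.
    · set B := A ∩ Γ.neighborSet v
      have hB : B ⊆ Γ.neighborSet v := Set.inter_subset_right
      have hvB : v ∉ B := fun h => Γ.loopless.irrefl v (hB h)
      have hF₁ : F₁ ≤ sub Γ G (insert v B) := by
        rintro _ ⟨f, hf, rfl⟩
        rw [hconj, Set.insert_inter_distrib]
        exact conj_retraction_mem (hF hf) (hy₀ f hf)
      have : Finite (F₁.map (retraction Γ G B)) := Subgroup.finite_map _ _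
      obtain ⟨z₀, C₀, hC₀, hz₀⟩ := ih (F₁.map (retraction Γ G B)) (by
        rintro _ ⟨f, hf, rfl⟩
        exact sub_mono Set.inter_subset_left (retraction_mem_sub B f))
      have hz := retraction_mem_sub B z₀
      refine ⟨retraction Γ G B z₀, insert v (B ∩ C₀), ?_, fun f hf => ?_⟩
      · exact (hC₀.subset Set.inter_subset_right).insert fun b hb _ => hB hb.1
      · obtain ⟨g, b, hb, rfl⟩ := exists_of_mul_of_mem_sub_insert hB (hF₁ hf)
        have h₁ := hz₀ _ (Subgroup.mem_map_of_mem _ hf)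
        rw [map_mul, retraction_of_notMem hvB, one_mul, retraction_eq_self hb] at h₁
        have h₂ := conj_retraction_mem hb h₁
        have h₃ : (retraction Γ G B z₀)⁻¹ * (of Γ G v g * b) * retraction Γ G B z₀ =
            of Γ G v g * ((retraction Γ G B z₀)⁻¹ * b * retraction Γ G B z₀) := by
          rw [← mul_assoc, ← (commute_of_mem_sub hB g (inv_mem hz)).eq]
          group
        rw [h₃]
        exact mul_mem (of_mem_sub (Set.mem_insert _ _) g) (sub_mono (Set.subset_insert _ _) h₂)

/-- For pairwise adjacent vertices, `G(C)` is an image of the finite direct product of the `G c`. -/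
theorem finite_sub_of_isClique [∀ v, Finite (G v)] {C : Set V} (hfin : C.Finite)
    (hC : Γ.IsClique C) : Finite (sub Γ G C) := by
  have := hfin.fintype
  have hcomm : Pairwise fun a b : C => ∀ (x : G a) (y : G b),
      Commute (of Γ G a x) (of Γ G b y) := fun a b hab x y =>
    commute_of_adj (hC a.2 b.2 fun e => hab (Subtype.ext e)) x y
  set φ := MonoidHom.noncommPiCoprod (fun a : C => of Γ G a) hcomm
  have hle : sub Γ G C ≤ φ.range := by
    rw [MonoidHom.noncommPiCoprod_range]
    exact sub_le_iff.mpr fun a ha g =>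
      Subgroup.mem_iSup_of_mem (⟨a, ha⟩ : C) (MonoidHom.mem_range.mpr ⟨g, rfl⟩)
  have : Finite φ.range := Set.finite_range φ |>.to_subtype
  exact Finite.of_injective _ (Subgroup.inclusion_injective hle)

/-! ### Comparing conjugates through the direct product. -/

variable (Γ G) in
open Classical in
/-- The canonical homomorphism from a graph product to the direct product of its vertex groups. -/
noncomputable def toPi : GraphProduct Γ G →* ∀ v, G v :=
  lift (MonoidHom.mulSingle G) fun _ _ hab g h => Pi.mulSingle_commute hab.ne g h

open Classical in
theorem toPi_of (v : V) (g : G v) : toPi Γ G (of Γ G v g) = Pi.mulSingle v g :=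
  lift_of _ _ v g

theorem toPi_of_same (v : V) (g : G v) : toPi Γ G (of Γ G v g) v = g := by
  classical
  rw [toPi_of]
  exact Pi.mulSingle_eq_same v g

theorem toPi_apply_of_mem_sub {A : Set V} {v : V} (hv : v ∉ A) {x : GraphProduct Γ G}
    (hx : x ∈ sub Γ G A) : toPi Γ G x v = 1 := by
  classical
  have h : sub Γ G A ≤ ((Pi.evalMonoidHom G v).comp (toPi Γ G)).ker := by
    refine sub_le_iff.mpr fun a ha g => ?_
    rw [MonoidHom.mem_ker, MonoidHom.comp_apply, toPi_of]
    exact Pi.mulSingle_eq_of_ne (fun e => hv (by rwa [e])) g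
  exact h hx

/-- For `c ∈ C ∖ D`, the coordinate at `c` kills every conjugate of `G(D)` but no conjugate of a
nontrivial element of `G c`. -/
theorem subset_of_map_conj_le [∀ v, Nontrivial (G v)] {C D : Set V} {g h : GraphProduct Γ G}
    (hle : (sub Γ G C).map (MulAut.conj g).toMonoidHom ≤
      (sub Γ G D).map (MulAut.conj h).toMonoidHom) : C ⊆ D := by
  intro c hc
  by_contra hcD
  obtain ⟨l, hl⟩ := exists_ne (1 : G c)
  obtain ⟨d, hd, hdl⟩ := hle (Subgroup.mem_map_of_mem _ (of_mem_sub hc l))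
  have h₁ := congrFun (congrArg (toPi Γ G) hdl) c
  simp only [MulEquiv.coe_toMonoidHom, MulAut.conj_apply, map_mul, map_inv, Pi.mul_apply,
    Pi.inv_apply] at h₁
  rw [toPi_apply_of_mem_sub hcD hd, toPi_of_same, mul_one, mul_inv_cancel] at h₁
  exact hl (conj_eq_one_iff.mp h₁.symm)

/-- A finite subgroup of a graph product is contained in a conjugate of `G(C)` for some maximal set
`C` of pairwise adjacent vertices. -/
theorem exists_le_map_conj_maximal_isClique [Finite V] (F : Subgroup (GraphProduct Γ G))
    [Finite F] : ∃ C : Set V, Maximal Γ.IsClique C ∧ ∃ g : GraphProduct Γ G,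
      F ≤ (sub Γ G C).map (MulAut.conj g).toMonoidHom := by
  obtain ⟨y, C₀, hC₀, hy⟩ := exists_conj_mem_clique (Set.toFinite Set.univ) F
    (by rw [sub_univ]; exact le_top)
  obtain ⟨C, hle, hC⟩ := (Set.toFinite {C : Set V | Γ.IsClique C}).exists_le_maximal hC₀
  refine ⟨C, hC, y, fun f hf => ⟨y⁻¹ * f * y, sub_mono hle (hy f hf), ?_⟩⟩
  simp only [MulEquiv.coe_toMonoidHom, MulAut.conj_apply]
  group

end GraphProduct

theorem mainTheorem5 {V : Type u} [Finite V] (Γ : SimpleGraph V) (G : V → Type w)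
    [∀ v, Group (G v)] [∀ v, Nontrivial (G v)] [∀ v, Finite (G v)]
    (F : Subgroup (GraphProduct Γ G)) :
    Maximal (fun H : Subgroup (GraphProduct Γ G) => Finite H) F ↔
      ∃ C : Set V, Maximal Γ.IsClique C ∧
        ∃ g : GraphProduct Γ G,
          F = (GraphProduct.sub Γ G C).map (MulAut.conj g).toMonoidHom := by
  have hfin : ∀ C : Set V, Γ.IsClique C → ∀ g : GraphProduct Γ G,
      Finite ((GraphProduct.sub Γ G C).map (MulAut.conj g).toMonoidHom) := fun C hC g =>
    have := GraphProduct.finite_sub_of_isClique (G := G) (Set.toFinite C) hC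
    Subgroup.finite_map _ _
  have hcard : ∀ (C : Set V) (g : GraphProduct Γ G),
      Nat.card ((GraphProduct.sub Γ G C).map (MulAut.conj g).toMonoidHom) =
        Nat.card (GraphProduct.sub Γ G C) := fun C g =>
    Subgroup.card_map_of_injective (MulAut.conj g).injective
  constructor
  · intro hF
    have := hF.prop
    obtain ⟨C, hC, g, hle⟩ := GraphProduct.exists_le_map_conj_maximal_isClique F
    exact ⟨C, hC, g, hF.eq_of_le (hfin C hC.prop g) hle⟩
  · rintro ⟨C, hC, g, rfl⟩
    refine ⟨hfin C hC.prop g, fun F' hF' hle => ?_⟩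
    have : Finite F' := hF'
    obtain ⟨D, hD, h, hle'⟩ := GraphProduct.exists_le_map_conj_maximal_isClique F'
    obtain rfl : C = D :=
      hC.eq_of_le hD.prop (GraphProduct.subset_of_map_conj_le (hle.trans hle'))
    have := hfin C hC.prop h
    -- Both ends of the chain are conjugates of the same finite `G(C)`, so equal orders make the
    -- chain collapse.
    have heq := Subgroup.eq_of_le_of_card_ge (hle.trans hle') (by rw [hcard, hcard])
    exact hle'.trans_eq heq.symm
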